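/- Let $G$ be a connected Lie group whose Lie algebra $\mathfrak g$ is $\mathfrak g_{4,8}^1$, i.e. has a basis $E_1,\dots,E_4$ with $[E_1,E_4]=2E_1$, $[E_2,E_4]=E_2$, $[E_3,E_4]=E_3$, $[E_2,E_3]=E_1$ and $[E_1,E_2]=[E_1,E_3]=0$. Let $\mathfrak q\subset\mathfrak g$ be a three-dimensional subspace generating $\mathfrak g$ as a Lie algebra, with a basis $(e_1,e_2,e_3)$ such that $[e_2,e_1]=e_1$ and $[e_2,e_3]=e_3$. Let $F:\mathfrak q\to\mathbb R$ be subadditive, positively homogeneous ($F(cu)=cF(u)$ for $c\ge 0$) and positive on nonzero vectors (so that $F$ defines a left-invariant sub-Finsler quasimetric on $G$); put $U=\{u\in\mathfrak q: F(u)\le 1\}$, $F(u_1,u_2,u_3)=F(u_1e_1+u_2e_2+u_3e_3)$ and $F_U(x,y,z)=\max\{xu_1+yu_2+zu_3 : u_1e_1+u_2e_2+u_3e_3\in U\}$. A locally absolutely continuous curve $g:\mathbb R\to G$ is an extremal with maximum value $M\ge 0$ if there are a measurable control $u:\mathbb R\to\mathfrak q$ and a nowhere zero locally absolutely continuous covector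 function $\psi(t)\in T^*_{g(t)}G$ such that, for almost all $t$: $\dot g(t)=dl_{g(t)}(u(t))$ and $F(u(t))=1$; the pair $(g,\psi)$ satisfies the Hamiltonian system of $\mathcal H(g,\psi,u)=\psi(dl_g(u))$ with $u=u(t)$ (the adjoint equation of the Pontryagin maximum principle); and $\psi(t)(dl_{g(t)}(u(t)))=\max_{w\in U}\psi(t)(dl_{g(t)}(w))=M$. It is called abnormal if this holds with $M=0$ for some $(u,\psi)$, normal if this holds with some $M>0$ for some $(u,\psi)$, and nonstrongly abnormal if it is both abnormal and normal. Then, for each $s\in\{1,-1\}$, the curve $g(t)=\exp\left(\frac{s\,t\,e_2}{F(se_2)}\right)$, $t\in\mathbb R$, and each of its left shifts $a\,g(t)$, $a\in G$, is an abnormal extremal, and it is nonstrongly abnormal if and only if $F_U(0,s,0)=1/F(0,s,0)$. -/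

import Mathlib

open scoped Manifold ContDiff
open MeasureTheory

noncomputable section

/-- Real finite smoothness exponents are at most `∞`; this makes the Lie algebra structure of the
tangent space at the identity available for every smooth Lie group. -/
instance instLEInftyMinSmoothnessThree : ENat.LEInfty (minSmoothness ℝ 3) :=
  ⟨by
    rw [minSmoothness_of_isRCLikeNormedField]
    exact ENat.LEInfty.out⟩

/-- The model space of four-dimensional manifolds. -/
abbrev Model4 : Type := EuclideanSpace ℝ (Fin 4)

/-- A real Lie algebra is (isomorphic to) `𝔤_{4,8}^1`: it has a basis `E₁, E₂, E₃, E₄` with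
`[E₁, E₄] = 2 E₁`, `[E₂, E₄] = E₂`, `[E₃, E₄] = E₃`, `[E₂, E₃] = E₁`, the other brackets of basis
vectors being zero. The indices `0, 1, 2, 3` stand for `1, 2, 3, 4`. -/
def IsG481 (L : Type*) [LieRing L] [LieAlgebra ℝ L] : Prop :=
  ∃ E : Module.Basis (Fin 4) ℝ L,
    ⁅E 0, E 3⁆ = (2 : ℝ) • E 0 ∧ ⁅E 1, E 3⁆ = E 1 ∧ ⁅E 2, E 3⁆ = E 2 ∧ ⁅E 1, E 2⁆ = E 0 ∧
    ⁅E 0, E 1⁆ = 0 ∧ ⁅E 0, E 2⁆ = 0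

/-- The (possibly nonsymmetric) seminorms defining sub-Finsler quasimetrics: subadditive,
positively homogeneous, and positive on nonzero vectors. -/
structure IsQuasinorm {V : Type*} [AddCommGroup V] [Module ℝ V] (F : V → ℝ) : Prop where
  add_le : ∀ u v : V, F (u + v) ≤ F u + F v
  smul_eq : ∀ (c : ℝ) (u : V), 0 ≤ c → F (c • u) = c * F u
  pos : ∀ u : V, u ≠ 0 → 0 < F u

/-- The Minkowski supporting function `F_U(x, y, z)` of the unit ball `U = {F ≤ 1}`, in the
coordinates `u = u₁ e₁ + u₂ e₂ + u₃ e₃` of a basis `e`. -/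
def supportingFunction {V : Type*} [AddCommGroup V] [Module ℝ V]
    (e : Module.Basis (Fin 3) ℝ V) (F : V → ℝ) (x y z : ℝ) : ℝ :=
  sSup {r : ℝ | ∃ u : V, F u ≤ 1 ∧ r = x * e.repr u 0 + y * e.repr u 1 + z * e.repr u 2}

/-- A real function on the line that is absolutely continuous on every compact interval. -/
def LocallyAC (f : ℝ → ℝ) : Prop := ∀ a b : ℝ, AbsolutelyContinuousOnInterval f a b

section LieGroup

variable {G : Type*} [Group G] [TopologicalSpace G] [ChartedSpace Model4 G]

/-- The one-parameter subgroup `t ↦ exp (t X)`: the integral curve through the identity of the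
left-invariant vector field with value `X` at the identity. On a Lie group it exists and is
unique, so the choice is no choice. -/
def oneParameterSubgroup (X : GroupLieAlgebra (𝓡 4) G) : ℝ → G :=
  Classical.epsilon fun γ : ℝ → G =>
    γ 0 = 1 ∧ IsMIntegralCurve γ (mulInvariantVectorField (I := 𝓡 4) X)

/-- The exponential map of a Lie group. -/
def lieExp (X : GroupLieAlgebra (𝓡 4) G) : G := oneParameterSubgroup X 1

/-- A curve in `G` that is absolutely continuous on every compact interval, i.e. its composition
with every smooth real function on `G` is. -/
def LocallyACCurve (g : ℝ → G) : Prop :=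
  ∀ f : G → ℝ, ContMDiff (𝓡 4) 𝓘(ℝ, ℝ) ∞ f → LocallyAC (f ∘ g)

/-- The Hamiltonian `H(g, ψ, u) = ψ(dl_g u)` in the canonical coordinates `(x, p)` of the cotangent
bundle given by the chart of `G` at `h`: here `x` are the coordinates of the point `g`, and
`p` is the covector `ψ` in these coordinates. -/
def chartHamiltonian (h : G) (u : GroupLieAlgebra (𝓡 4) G) (x : Model4) (p : Model4 →L[ℝ] ℝ) : ℝ :=
  p (mfderiv (𝓡 4) 𝓘(ℝ, Model4) (extChartAt (𝓡 4) h) ((extChartAt (𝓡 4) h).symm x)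
    (mulInvariantVectorField (I := 𝓡 4) u ((extChartAt (𝓡 4) h).symm x)))

/-- The coordinates `p` of a covector `ψ ∈ T*_g G` in the chart of `G` at `h`. -/
def chartCovector (h g : G) (ψ : TangentSpace (𝓡 4) g →L[ℝ] ℝ) : Model4 →L[ℝ] ℝ :=
  ψ ∘L (mfderiv (𝓡 4) 𝓘(ℝ, Model4) (extChartAt (𝓡 4) h) g).inverse

/-- The Pontryagin maximum principle, with maximum value `M`, on the whole line, for the
time-optimal problem `ġ = dl_g u`, `u ∈ U = {u ∈ 𝔮 | F u ≤ 1}`, for a curve `g` parametrized by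
arclength, with control `u` and covector function `ψ(t) ∈ T*_{g(t)} G`. -/
structure SatisfiesPMP (q : Submodule ℝ (GroupLieAlgebra (𝓡 4) G)) (F : q → ℝ) (g : ℝ → G)
    (u : ℝ → q) (ψ : (t : ℝ) → (TangentSpace (𝓡 4) (g t) →L[ℝ] ℝ)) (M : ℝ) : Prop where
  curve_ac : LocallyACCurve g
  /-- The control is (Lebesgue) measurable. -/
  control_meas : AEStronglyMeasurable u volume
  /-- The control system `ġ(t) = dl_{g(t)} u(t)`. -/
  velocity : ∀ᵐ t : ℝ, HasMFDerivAt 𝓘(ℝ, ℝ) (𝓡 4) g t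
    ((1 : ℝ →L[ℝ] ℝ).smulRight (mulInvariantVectorField (I := 𝓡 4) (u t : GroupLieAlgebra (𝓡 4) G)
      (g t)))
  /-- Parametrization by arclength. -/
  arclength : ∀ᵐ t : ℝ, F (u t) = 1
  covector_ne_zero : ∀ t : ℝ, ψ t ≠ 0
  /-- The covector function is absolutely continuous: its components in every left-invariant
  frame are. -/
  covector_ac : ∀ v : GroupLieAlgebra (𝓡 4) G,
    LocallyAC fun t => ψ t (mulInvariantVectorField (I := 𝓡 4) v (g t))
  /-- The adjoint half `ṗ = -∂H/∂x` of the Hamiltonian system, for almost all times, in the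
  canonical coordinates given by the chart at the current point (the equation does not depend on
  the chart). The other half `ẋ = ∂H/∂p` is the control system. -/
  adjoint : ∀ᵐ t : ℝ, HasDerivAt (fun τ => chartCovector (g t) (g τ) (ψ τ))
    (-fderiv ℝ (fun x => chartHamiltonian (g t) (u t : GroupLieAlgebra (𝓡 4) G) x
      (chartCovector (g t) (g t) (ψ t))) (extChartAt (𝓡 4) (g t) (g t))) t
  /-- The maximum condition: `M = ψ(t)(dl_{g(t)} u(t)) = max_{w ∈ U} ψ(t)(dl_{g(t)} w)`. -/
  maximum : ∀ᵐ t : ℝ,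
    ψ t (mulInvariantVectorField (I := 𝓡 4) (u t : GroupLieAlgebra (𝓡 4) G) (g t)) = M ∧
    ∀ w : q, F w ≤ 1 →
      ψ t (mulInvariantVectorField (I := 𝓡 4) (w : GroupLieAlgebra (𝓡 4) G) (g t)) ≤ M

/-- An abnormal extremal defined on the whole line (then its domain is clearly maximal): it
satisfies the maximum principle with `M = 0`. -/
def IsAbnormalExtremal (q : Submodule ℝ (GroupLieAlgebra (𝓡 4) G)) (F : q → ℝ) (g : ℝ → G) :
    Prop :=
  ∃ (u : ℝ → q) (ψ : (t : ℝ) → (TangentSpace (𝓡 4) (g t) →L[ℝ] ℝ)), SatisfiesPMP q F g u ψ 0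

/-- A normal extremal defined on the whole line: it satisfies the maximum principle with some
`M > 0`. -/
def IsNormalExtremal (q : Submodule ℝ (GroupLieAlgebra (𝓡 4) G)) (F : q → ℝ) (g : ℝ → G) :
    Prop :=
  ∃ (u : ℝ → q) (ψ : (t : ℝ) → (TangentSpace (𝓡 4) (g t) →L[ℝ] ℝ)) (M : ℝ),
    0 < M ∧ SatisfiesPMP q F g u ψ M

/-- A nonstrongly abnormal extremal is both abnormal and normal, with respect to different
covector functions. -/
def IsNonstronglyAbnormal (q : Submodule ℝ (GroupLieAlgebra (𝓡 4) G)) (F : q → ℝ) (g : ℝ → G) :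
    Prop :=
  IsAbnormalExtremal q F g ∧ IsNormalExtremal q F g

end LieGroup

end

/-! Left translations turn the covector into a curve `l(t)` in the dual of the Lie algebra, and the
adjoint equation becomes `l'(v) = l([u, v])` (`hasDerivAt_chartCovector_iff`). The curve in question
has constant control `c e₂` with `c = s / F(s e₂)`. Since the subspace generates a four-dimensional
algebra, `[e₁, e₃]` lies outside it, and `e₁, e₂, e₃, [e₁, e₃]` is an eigenbasis of `ad e₂` with
eigenvalues `1, 0, 1, 2`. The components of `l(t)` are therefore exponentials.

Abnormality: the functional dual to `[e₁, e₃]`, multiplied by `e^{2ct}`, solves the equation and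
vanishes on `𝔮`, so `M = 0`.

Normality: let `pᵢ` be the components of `l(t)` on `eᵢ`. Then `p₂` is constant, `M = c p₂`, and `p₁,
p₃` are multiples of `e^{ct}`. Letting `ct → -∞` in the maximum condition leaves `w₂ p₂ ≤ c p₂`,
that is `s w₂ ≤ 1 / F(s e₂)` on the unit ball (`SatisfiesPMP.coord_mul_inv_le_one`). Conversely,
this bound makes `s` times the functional dual to `e₂` a constant covector with `M = 1 / F(s e₂)`.
The bound is equivalent to the stated equality because `s e₂ / F(s e₂)` always attains it
(`supportingFunction_eq_iff`). -/

section AbsoluteContinuity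

/-! ### Absolutely continuous solutions of scalar linear equations. -/

theorem ContDiff.locallyAC {f : ℝ → ℝ} (hf : ContDiff ℝ 1 f) : LocallyAC f := fun _ _ =>
  hf.contDiffOn.absolutelyContinuousOnInterval

/-- A locally absolutely continuous solution of `f' = k f` is an exponential. -/
theorem LocallyAC.eq_exp_of_ae_hasDerivAt {f : ℝ → ℝ} (hf : LocallyAC f) {k : ℝ}
    (h : ∀ᵐ t : ℝ, HasDerivAt f (k * f t) t) (t : ℝ) : f t = f 0 * Real.exp (k * t) := by
  have hexp : LocallyAC fun t => Real.exp (-k * t) := ContDiff.locallyAC (by fun_prop)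
  -- The product `f(t) e^{-kt}` has zero derivative almost everywhere; absolute continuity makes it
  -- constant.
  have hconst := ((hf 0 t).mul (hexp 0 t)).const_of_ae_hasDerivAt_zero (by
    filter_upwards [h] with x hx _
    have hlin : HasDerivAt (fun y : ℝ => -k * y) (-k * 1) x := (hasDerivAt_id x).const_mul (-k)
    refine (hx.mul hlin.exp).congr_deriv ?_
    ring)
  obtain ⟨C, hC⟩ := hconst
  have h0 := hC 0 Set.left_mem_uIcc
  have ht := hC t Set.right_mem_uIcc
  simp only [Pi.mul_apply, mul_zero, Real.exp_zero, mul_one] at h0 ht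
  rw [h0, ← ht, mul_assoc, ← Real.exp_add]
  simp

/-- If `c + a e^{kt} ≤ M` for almost all `t`, where `k ≠ 0`, then `c ≤ M`. -/
theorem le_of_ae_add_mul_exp_le {k a c M : ℝ} (hk : k ≠ 0)
    (h : ∀ᵐ t : ℝ, c + a * Real.exp (k * t) ≤ M) : c ≤ M := by
  -- The set of good times is closed, and dense because its complement is null.
  have hall : ∀ t : ℝ, c + a * Real.exp (k * t) ≤ M := by
    have hd : Dense {t : ℝ | c + a * Real.exp (k * t) ≤ M} := Measure.dense_of_ae h
    have hcl : IsClosed {t : ℝ | c + a * Real.exp (k * t) ≤ M} :=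
      isClosed_le (by fun_prop) continuous_const
    intro t
    have := hcl.closure_eq ▸ hd t
    exact this
  -- Evaluating at `t / k` makes the exponential decay as `t → -∞` whatever the sign of `k`.
  have hlim : Filter.Tendsto (fun t : ℝ => c + a * Real.exp (k * (t / k))) Filter.atBot
      (nhds (c + a * 0)) := by
    have : ∀ t : ℝ, k * (t / k) = t := fun t => by field_simp
    simp only [this]
    exact tendsto_const_nhds.add (Real.tendsto_exp_atBot.const_mul a)
  simpa using le_of_tendsto' hlim fun t => hall (t / k)

end AbsoluteContinuity

/-! ### Quasinorms and the supporting function of the unit ball. -/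

section Quasinorm

variable {V : Type*} [AddCommGroup V] [Module ℝ V] {F : V → ℝ}

theorem IsQuasinorm.map_inv_smul_self (hF : IsQuasinorm F) {v : V} (hv : v ≠ 0) :
    F ((F v)⁻¹ • v) = 1 := by
  rw [hF.smul_eq _ _ (inv_nonneg.2 (hF.pos v hv).le), inv_mul_cancel₀ (hF.pos v hv).ne']

theorem IsQuasinorm.map_zero (hF : IsQuasinorm F) : F 0 = 0 := by
  simpa using hF.smul_eq 0 0 le_rfl

theorem IsQuasinorm.convexOn (hF : IsQuasinorm F) : ConvexOn ℝ Set.univ F := by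
  refine ⟨convex_univ, fun x _ y _ a b ha hb _ => ?_⟩
  rw [smul_eq_mul, smul_eq_mul, ← hF.smul_eq _ _ ha, ← hF.smul_eq _ _ hb]
  exact hF.add_le (a • x) (b • y)

/-- A quasinorm on a space with a finite basis dominates a multiple of the norm of the
coordinate vector. -/
theorem IsQuasinorm.exists_mul_norm_le (hF : IsQuasinorm F) {ι : Type*} [Fintype ι] [Nonempty ι]
    (e : Module.Basis ι ℝ V) : ∃ m > 0, ∀ u : V, m * ‖e.equivFun u‖ ≤ F u := by
  -- Continuity is not assumed of `F`; it follows from convexity in finite dimension. The constant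
  -- is then the minimum of `F` on the unit sphere of coordinates.
  have hcont : Continuous (F ∘ e.equivFun.symm) := by
    have := (hF.convexOn.comp_linearMap e.equivFun.symm.toLinearMap).continuousOn isOpen_univ
    exact continuousOn_univ.1 this
  obtain ⟨x, hx, hmin⟩ := (isCompact_sphere (0 : ι → ℝ) 1).exists_isMinOn
    (NormedSpace.sphere_nonempty.2 zero_le_one) hcont.continuousOn
  refine ⟨F (e.equivFun.symm x), hF.pos _ ?_, fun u => ?_⟩
  · rw [Ne, LinearEquiv.map_eq_zero_iff]
    rintro rfl
    simp at hx
  · rcases eq_or_ne u 0 with rfl | hu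
    · simp [hF.map_zero]
    have hnorm : 0 < ‖e.equivFun u‖ := by
      rw [norm_pos_iff, Ne, LinearEquiv.map_eq_zero_iff]
      exact hu
    have := hmin (show ‖e.equivFun u‖⁻¹ • e.equivFun u ∈ Metric.sphere 0 1 by
      rw [mem_sphere_zero_iff_norm, norm_smul, norm_inv, norm_norm, inv_mul_cancel₀ hnorm.ne'])
    simp only [Set.mem_ofPred_eq, Function.comp_apply, map_smul, LinearEquiv.symm_apply_apply,
      hF.smul_eq _ _ (inv_nonneg.2 hnorm.le)] at this
    rwa [← div_eq_inv_mul, le_div_iff₀ hnorm] at this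

/-- Without boundedness the real `sSup` in `supportingFunction` would take its default value `0`. -/
theorem IsQuasinorm.bddAbove_coord (hF : IsQuasinorm F) (e : Module.Basis (Fin 3) ℝ V)
    (x y z : ℝ) :
    BddAbove {r : ℝ | ∃ u : V, F u ≤ 1 ∧ r = x * e.repr u 0 + y * e.repr u 1 + z * e.repr u 2} := by
  obtain ⟨m, hm, hle⟩ := hF.exists_mul_norm_le e
  refine ⟨(|x| + |y| + |z|) * m⁻¹, ?_⟩
  rintro r ⟨u, hu, rfl⟩
  have hcoord : ∀ i, |e.repr u i| ≤ m⁻¹ := fun i => by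
    have h1 : ‖e.equivFun u i‖ ≤ ‖e.equivFun u‖ := norm_le_pi_norm _ i
    rw [Module.Basis.equivFun_apply, Real.norm_eq_abs] at h1
    refine h1.trans ?_
    rw [← one_div, le_div_iff₀ hm, mul_comm]
    exact (hle u).trans hu
  have hterm : ∀ (a : ℝ) (i : Fin 3), a * e.repr u i ≤ |a| * m⁻¹ := fun a i =>
    (le_abs_self _).trans ((abs_mul _ _).trans_le (by gcongr; exact hcoord i))
  linarith [hterm x 0, hterm y 1, hterm z 2]

theorem le_supportingFunction (hF : IsQuasinorm F) (e : Module.Basis (Fin 3) ℝ V) (x y z : ℝ)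
    {u : V} (hu : F u ≤ 1) :
    x * e.repr u 0 + y * e.repr u 1 + z * e.repr u 2 ≤ supportingFunction e F x y z :=
  le_csSup (hF.bddAbove_coord e x y z) ⟨u, hu, rfl⟩

/-- The supporting function attains its lower bound `1 / F (s e₂)` at `(0, s, 0)` exactly when the
`e₂`-coordinate is bounded correspondingly on the unit ball. -/
theorem supportingFunction_eq_iff (hF : IsQuasinorm F) (e : Module.Basis (Fin 3) ℝ V) {s : ℝ}
    (hs : s * s = 1) :
    supportingFunction e F 0 s 0 = 1 / F (s • e 1) ↔
      ∀ w : V, F w ≤ 1 → s * e.repr w 1 ≤ 1 / F (s • e 1) := by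
  have hs0 : s ≠ 0 := by rintro rfl; simp at hs
  have hv : s • e 1 ≠ 0 := smul_ne_zero hs0 (e.ne_zero 1)
  constructor
  · intro h w hw
    rw [← h]
    simpa using le_supportingFunction hF e 0 s 0 hw
  · intro h
    apply le_antisymm
    · refine csSup_le ⟨0, 0, by simp [hF.map_zero], by simp⟩ ?_
      rintro r ⟨u, hu, rfl⟩
      simpa using h u hu
    -- The witness `s e₂ / F(s e₂)` has `e₂`-coordinate `s / F(s e₂)`, and `s * s = 1`.
    · have := le_supportingFunction hF e 0 s 0 (hF.map_inv_smul_self hv).le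
      simp at this
      rw [one_div]
      refine le_trans (le_of_eq ?_) this
      linear_combination (-(F (s • e 1))⁻¹) * hs

end Quasinorm

/-! ### The eigenbasis of `ad e₂` and its dual functionals. -/

section LieAlgebra

variable {L : Type*} [LieRing L] [LieAlgebra ℝ L]

/-- A subspace with a basis whose brackets lie in it does not generate a larger Lie algebra. -/
theorem lieSpan_le_of_basis {ι : Type*} [Fintype ι] (q : Submodule ℝ L)
    (e : Module.Basis ι ℝ q) (h : ∀ i j, ⁅(e i : L), (e j : L)⁆ ∈ q) :
    (LieSubalgebra.lieSpan ℝ L (q : Set L)).toSubmodule ≤ q := by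
  have hclosed : ∀ {x y : L}, x ∈ q → y ∈ q → ⁅x, y⁆ ∈ q := by
    intro x y hx hy
    have hsum : ∀ u : q, (u : L) = ∑ i, e.repr u i • (e i : L) := fun u =>
      (congrArg q.subtype (e.sum_repr u)).symm.trans (by simp only [map_sum, map_smul]; rfl)
    have hx' := hsum ⟨x, hx⟩
    have hy' := hsum ⟨y, hy⟩
    simp only at hx' hy'
    rw [hx', hy', sum_lie_sum]
    refine sum_mem fun i _ => sum_mem fun j _ => ?_
    rw [smul_lie, lie_smul]
    exact q.smul_mem _ (q.smul_mem _ (h i j))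
  let K : LieSubalgebra ℝ L := { q with lie_mem' := hclosed }
  exact (LieSubalgebra.lieSpan_le (K := K)).2 fun _ hx => hx

/-- In a four-dimensional Lie algebra generated by a subspace with a basis `e₁, e₂, e₃` with
`[e₂, e₁] = e₁` and `[e₂, e₃] = e₃`, the vectors `e₁, e₂, e₃, [e₁, e₃]` form a basis. -/
theorem exists_basis_of_lieSpan_eq_top (hL : Module.finrank ℝ L = 4) (q : Submodule ℝ L)
    (hq : LieSubalgebra.lieSpan ℝ L (q : Set L) = ⊤) (e : Module.Basis (Fin 3) ℝ q)
    (he1 : ⁅(e 1 : L), (e 0 : L)⁆ = e 0) (he3 : ⁅(e 1 : L), (e 2 : L)⁆ = e 2) :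
    ∃ b : Module.Basis (Fin 4) ℝ L,
      b 0 = e 0 ∧ b 1 = e 1 ∧ b 2 = e 2 ∧ b 3 = ⁅(e 0 : L), (e 2 : L)⁆ := by
  -- Otherwise `q` would be closed under brackets, hence all of `L`, against dimension 3.
  have hnot : ⁅(e 0 : L), (e 2 : L)⁆ ∉ q := by
    intro hmem
    have h10 : ⁅(e 0 : L), (e 1 : L)⁆ ∈ q := by
      rw [← lie_skew, he1]; exact neg_mem (e 0).2
    have h21 : ⁅(e 2 : L), (e 1 : L)⁆ ∈ q := by
      rw [← lie_skew, he3]; exact neg_mem (e 2).2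
    have h20 : ⁅(e 2 : L), (e 0 : L)⁆ ∈ q := by
      rw [← lie_skew]; exact neg_mem hmem
    have hle := lieSpan_le_of_basis q e (by
      intro i j
      fin_cases i <;> fin_cases j <;> simp [he1, he3, h10, h21, h20, hmem])
    rw [hq] at hle
    have hqtop : q = ⊤ := top_le_iff.1 (by simpa using hle)
    have hdim : Module.finrank ℝ q = 3 := by simp [Module.finrank_eq_card_basis e]
    rw [hqtop, finrank_top, hL] at hdim
    omega
  have hli : LinearIndependent ℝ
      (Fin.snoc (fun i => (e i : L)) ⁅(e 0 : L), (e 2 : L)⁆ : Fin 4 → L) := by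
    rw [linearIndependent_finSnoc]
    refine ⟨e.linearIndependent.map' q.subtype q.ker_subtype, fun h => hnot ?_⟩
    exact Submodule.span_le.2 (by rintro _ ⟨i, rfl⟩; exact (e i).2) h
  have : FiniteDimensional ℝ L := Module.finite_of_finrank_pos (by omega)
  refine ⟨basisOfLinearIndependentOfCardEqFinrank hli (by simp [hL]), ?_, ?_, ?_, ?_⟩ <;>
    rw [coe_basisOfLinearIndependentOfCardEqFinrank] <;> rfl

/-- Eigencovectors of the coadjoint action of `e₂`: one annihilating the generating subspace, one
equal to the `e₂`-coordinate on it. -/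
theorem exists_eigencovectors (hL : Module.finrank ℝ L = 4) (q : Submodule ℝ L)
    (hq : LieSubalgebra.lieSpan ℝ L (q : Set L) = ⊤) (e : Module.Basis (Fin 3) ℝ q)
    (he1 : ⁅(e 1 : L), (e 0 : L)⁆ = e 0) (he3 : ⁅(e 1 : L), (e 2 : L)⁆ = e 2) :
    (∃ l : L →ₗ[ℝ] ℝ, l ≠ 0 ∧ (∀ u : q, l u = 0) ∧ ∀ v, l ⁅(e 1 : L), v⁆ = 2 * l v) ∧
    (∃ l : L →ₗ[ℝ] ℝ, l ≠ 0 ∧ (∀ u : q, l u = e.repr u 1) ∧ ∀ v, l ⁅(e 1 : L), v⁆ = 0 * l v) := by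
  obtain ⟨b, h0, h1, h2, h3⟩ := exists_basis_of_lieSpan_eq_top hL q hq e he1 he3
  have b10 : ⁅(e 1 : L), b 0⁆ = b 0 := by rw [h0, he1]
  have b11 : ⁅(e 1 : L), b 1⁆ = 0 := by rw [h1, lie_self]
  have b12 : ⁅(e 1 : L), b 2⁆ = b 2 := by rw [h2, he3]
  -- By the Leibniz rule the eigenvalues of `e₁` and `e₃` add up: `1 + 1 = 2`.
  have b13 : ⁅(e 1 : L), b 3⁆ = (2 : ℝ) • b 3 := by
    rw [h3, leibniz_lie, he1, he3, two_smul]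
  have hon (l m : L →ₗ[ℝ] ℝ) (h : ∀ i, l (b i) = m (b i)) (v : L) : l v = m v := by
    rw [b.ext h]
  have honq (l : L →ₗ[ℝ] ℝ) (m : q →ₗ[ℝ] ℝ) (h : ∀ i, l (e i) = m (e i)) (u : q) :
      l u = m u := by
    change (l ∘ₗ q.subtype) u = m u
    rw [e.ext (f₁ := l ∘ₗ q.subtype) (f₂ := m) h]
  have hb : ∀ i : Fin 3, (e i : L) = b i.castSucc := by
    intro i; fin_cases i <;> simp [h0, h1, h2]
  refine ⟨⟨b.coord 3, ?_, ?_, ?_⟩, ⟨b.coord 1, ?_, ?_, ?_⟩⟩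
  · intro h
    simpa using congrArg (fun l => l (b 3)) h
  · refine honq (b.coord 3) 0 fun i => ?_
    rw [hb]; fin_cases i <;> simp
  · refine hon (b.coord 3 ∘ₗ (LieAlgebra.ad ℝ L (e 1 : L))) ((2 : ℝ) • b.coord 3) fun i => ?_
    fin_cases i <;> simp [b10, b11, b12, b13]
  · intro h
    simpa using congrArg (fun l => l (b 1)) h
  · refine honq (b.coord 1) (e.coord 1) fun i => ?_
    rw [hb]; fin_cases i <;> simp
  · refine hon (b.coord 1 ∘ₗ (LieAlgebra.ad ℝ L (e 1 : L))) ((0 : ℝ) • b.coord 1) fun i => ?_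
    fin_cases i <;> simp [b10, b11, b12, b13]

end LieAlgebra

/-! ### Left-invariant fields, their integral curves and the exponential map. -/

section LieGroupCurves

open scoped Topology
open VectorField Set

variable {G : Type*} [Group G] [TopologicalSpace G] [ChartedSpace Model4 G] [LieGroup (𝓡 4) ∞ G]

theorem mdiff_mul_left (a g : G) : MDifferentiableAt (𝓡 4) (𝓡 4) (a * ·) g :=
  (contMDiff_mul_left (n := ∞)).contMDiffAt.mdifferentiableAt (by simp)

theorem mfderiv_mul_left_mulInvariantVectorField (a g : G) (v : GroupLieAlgebra (𝓡 4) G) :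
    mfderiv (𝓡 4) (𝓡 4) (a * ·) g (mulInvariantVectorField v g) =
      mulInvariantVectorField v (a * g) := by
  have hcomp : (a * g * ·) = (a * ·) ∘ (g * · : G → G) := by
    ext x; simp [mul_assoc]
  -- The chain rule yields a derivative at `g * 1`, whose tangent space is not syntactically the one
  -- at `g`; generalizing the base point avoids a transport.
  have key : ∀ g' : G, g' = g * 1 →
      (mfderiv (𝓡 4) (𝓡 4) (a * ·) g' : Model4 →L[ℝ] Model4) (mfderiv (𝓡 4) (𝓡 4) (g * ·) 1 v) =
        (mfderiv (𝓡 4) (𝓡 4) (a * g * ·) 1 : Model4 →L[ℝ] Model4) v := by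
    rintro _ rfl
    rw [hcomp, mfderiv_comp (I' := 𝓡 4) _ (mdiff_mul_left _ _) (mdiff_mul_left _ _)]
    rfl
  exact key g (mul_one g).symm

theorem isInvertible_mfderiv_mul_left (g h : G) :
    (mfderiv (𝓡 4) (𝓡 4) (g * ·) h).IsInvertible := by
  apply ContinuousLinearMap.IsInvertible.of_inverse (g := mfderiv (𝓡 4) (𝓡 4) (g⁻¹ * ·) (g * h))
  · have hid : (g * ·) ∘ (g⁻¹ * ·) = (id : G → G) := by ext x; simp
    have key : ∀ h' : G, h' = g⁻¹ * (g * h) →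
        (mfderiv (𝓡 4) (𝓡 4) (g * ·) h' : Model4 →L[ℝ] Model4) ∘L
          mfderiv (𝓡 4) (𝓡 4) (g⁻¹ * ·) (g * h) = ContinuousLinearMap.id ℝ Model4 := by
      rintro _ rfl
      have := mfderiv_comp (I := 𝓡 4) (I' := 𝓡 4) (I'' := 𝓡 4) (g * h)
        (mdiff_mul_left g _) (mdiff_mul_left g⁻¹ (g * h))
      rw [hid, mfderiv_id] at this
      exact this.symm
    exact key h (by simp)
  · have hid : (g⁻¹ * ·) ∘ (g * ·) = (id : G → G) := by ext x; simp
    have := mfderiv_comp (I := 𝓡 4) (I' := 𝓡 4) (I'' := 𝓡 4) h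
        (mdiff_mul_left g⁻¹ _) (mdiff_mul_left g h)
    rw [hid, mfderiv_id] at this
    exact this.symm

theorem IsMIntegralCurveOn.mul_left {v : GroupLieAlgebra (𝓡 4) G} {γ : ℝ → G} {s : Set ℝ}
    (hγ : IsMIntegralCurveOn γ (mulInvariantVectorField (I := 𝓡 4) v) s) (a : G) :
    IsMIntegralCurveOn (fun t => a * γ t) (mulInvariantVectorField (I := 𝓡 4) v) s := by
  intro t ht
  have := (mdiff_mul_left a (γ t)).hasMFDerivAt.comp_hasMFDerivWithinAt t (hγ t ht)
  have key : (mfderiv (𝓡 4) (𝓡 4) (a * ·) (γ t)).comp ((1 : ℝ →L[ℝ] ℝ).smulRight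
      (mulInvariantVectorField v (γ t))) =
        (1 : ℝ →L[ℝ] ℝ).smulRight (mulInvariantVectorField v (a * γ t)) := by
    rw [← mfderiv_mul_left_mulInvariantVectorField a (γ t) v]
    refine ContinuousLinearMap.ext fun c => ?_
    exact map_smul (mfderiv (𝓡 4) (𝓡 4) (a * ·) (γ t)) c _
  exact key ▸ this

theorem contMDiff_one_mulInvariantVectorField (v : GroupLieAlgebra (𝓡 4) G) :
    ContMDiff (𝓡 4) (𝓡 4).tangent 1
      (fun g : G => (⟨g, mulInvariantVectorField v g⟩ : TangentBundle (𝓡 4) G)) :=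
  (contMDiff_mulInvariantVectorField v).of_le (le_trans (by norm_num) le_minSmoothness)

variable [T2Space G]

theorem exists_isMIntegralCurve_mulInvariantVectorField (v : GroupLieAlgebra (𝓡 4) G) :
    ∃ γ : ℝ → G, γ 0 = 1 ∧ IsMIntegralCurve γ (mulInvariantVectorField (I := 𝓡 4) v) := by
  have : IsManifold (𝓡 4) 1 G := inferInstance
  obtain ⟨γ, h0, hγ⟩ := exists_isMIntegralCurveAt_of_contMDiffAt_boundaryless (t₀ := 0)
    (contMDiff_one_mulInvariantVectorField v (1 : G))
  obtain ⟨ε, hε, hγ⟩ := isMIntegralCurveAt_iff'.1 hγ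
  -- Left translates of one local curve through `1` give the same existence time `ε` at every point,
  -- which forces completeness.
  refine exists_isMIntegralCurve_of_isMIntegralCurveOn (contMDiff_one_mulInvariantVectorField v) hε
    (fun x => ⟨fun t => x * γ t, by simp [h0], ?_⟩) 1
  change IsMIntegralCurveOn γ _ (Metric.ball 0 ε) at hγ
  rw [Real.ball_eq_Ioo] at hγ
  simpa using hγ.mul_left x

theorem oneParameterSubgroup_spec (v : GroupLieAlgebra (𝓡 4) G) :
    oneParameterSubgroup v 0 = 1 ∧
      IsMIntegralCurve (oneParameterSubgroup v) (mulInvariantVectorField (I := 𝓡 4) v) :=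
  Classical.epsilon_spec (exists_isMIntegralCurve_mulInvariantVectorField v)

/-- Rescaling time by `t` turns the curve of `v` into an integral curve of `t • v`; uniqueness
identifies the two at time 1. -/
theorem lieExp_smul (v : GroupLieAlgebra (𝓡 4) G) (t : ℝ) :
    lieExp (t • v) = oneParameterSubgroup v t := by
  have hcurve : IsMIntegralCurve (oneParameterSubgroup v ∘ (· * t))
      (mulInvariantVectorField (I := 𝓡 4) (t • v)) := by
    rw [mulInvariantVectorField_smul]
    exact (oneParameterSubgroup_spec v).2.comp_mul t
  have heq := isMIntegralCurve_Ioo_eq_of_contMDiff_boundaryless (t₀ := 0)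
    (contMDiff_one_mulInvariantVectorField (t • v)) (oneParameterSubgroup_spec (t • v)).2 hcurve
    (by simp [(oneParameterSubgroup_spec _).1])
  simpa [lieExp] using congrFun heq 1

theorem isMIntegralCurve_mul_lieExp (v : GroupLieAlgebra (𝓡 4) G) (a : G) (c : ℝ) :
    IsMIntegralCurve (fun t : ℝ => a * lieExp ((t * c) • v))
      (mulInvariantVectorField (I := 𝓡 4) (c • v)) := by
  simp only [lieExp_smul]
  rw [mulInvariantVectorField_smul]
  have := isMIntegralCurve_iff_isMIntegralCurveOn.2
    ((isMIntegralCurve_iff_isMIntegralCurveOn.1 (oneParameterSubgroup_spec v).2).mul_left a)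
  exact this.comp_mul c

end LieGroupCurves

/-! ### The adjoint equation in a moving frame of a vector space. -/

section Calculus

open scoped Topology
open VectorField Set

/-- On a finite-dimensional space, an operator-valued function that is differentiable in the strong
sense is differentiable. -/
theorem differentiableAt_of_forall_apply {D E F : Type*} [NormedAddCommGroup D] [NormedSpace ℝ D]
    [NormedAddCommGroup E] [NormedSpace ℝ E] [FiniteDimensional ℝ E] [NormedAddCommGroup F]
    [NormedSpace ℝ F] {f : D → E →L[ℝ] F} {x : D}
    (h : ∀ v, DifferentiableAt ℝ (fun y => f y v) x) : DifferentiableAt ℝ f x := by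
  let b := Module.finBasis ℝ E
  have hf : f = fun y => ∑ i, ContinuousLinearMap.smulRightL ℝ E F
      (LinearMap.toContinuousLinearMap (b.coord i)) (f y (b i)) := by
    funext y
    refine ContinuousLinearMap.coe_injective (b.ext fun j => ?_)
    simp [Finsupp.single_apply, ite_smul]
  rw [hf]
  exact DifferentiableAt.fun_sum fun i _ =>
    (ContinuousLinearMap.differentiableAt _).comp x (h (b i))

/-- For a covector `P` moving along a curve `x` with velocity `A(x) u`, where `A` is a frame field,
the adjoint equation is equivalent to an equation for the components of `P` in the frame. -/
theorem hasDerivAt_covector_iff {E : Type*} [NormedAddCommGroup E] [NormedSpace ℝ E]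
    [FiniteDimensional ℝ E] {A : E → E →L[ℝ] E} {P : ℝ → E →L[ℝ] ℝ} {x : ℝ → E} {t : ℝ} {u : E}
    (hx : HasDerivAt x (A (x t) u) t) (hA : DifferentiableAt ℝ A (x t))
    (hinv : ∀ᶠ τ in 𝓝 t, (A (x τ)).IsInvertible) :
    HasDerivAt P (-(P t ∘L fderiv ℝ (fun y => A y u) (x t))) t ↔
      ∀ v, HasDerivAt (fun τ => P τ (A (x τ) v))
        (P t (lieBracket ℝ (fun y => A y u) (fun y => A y v) (x t))) t := by
  have hAx : HasDerivAt (fun τ => A (x τ)) (fderiv ℝ A (x t) (A (x t) u)) t :=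
    hA.hasFDerivAt.comp_hasDerivAt t hx
  have hfd (v : E) : fderiv ℝ (fun y => A y v) (x t) = (fderiv ℝ A (x t)).flip v := by
    ext w
    simp [fderiv_clm_apply hA (differentiableAt_const v)]
  -- In this product rule the term from `P'` and the term from the derivative of the frame are the
  -- two halves of the Lie bracket.
  have hprod {P' : E →L[ℝ] ℝ} (hP : HasDerivAt P P' t) (v : E) :
      HasDerivAt (fun τ => P τ (A (x τ) v))
        (P' (A (x t) v) + P t (fderiv ℝ A (x t) (A (x t) u) v)) t := by
    have := hP.clm_apply (hAx.clm_apply (hasDerivAt_const t v))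
    simpa using this
  simp only [lieBracket, hfd, ContinuousLinearMap.flip_apply, map_sub]
  constructor
  · intro hP v
    refine (hprod hP v).congr_deriv ?_
    simp only [neg_apply, ContinuousLinearMap.comp_apply, ContinuousLinearMap.flip_apply]
    ring
  · intro h
    -- Only the frame components of `P` are known to be differentiable; `P` is recovered as `(P ∘ A)
    -- ∘ A⁻¹`, inversion being smooth at invertible operators.
    have hcomp : DifferentiableAt ℝ (fun τ => P τ ∘L A (x τ)) t :=
      differentiableAt_of_forall_apply fun v => (h v).differentiableAt
    have hmap : DifferentiableAt ℝ ContinuousLinearMap.inverse (A (x t)) :=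
      (hinv.self_of_nhds.contDiffAt_map_inverse (n := 1)).differentiableAt (by simp)
    have hAinv : DifferentiableAt ℝ (fun τ => (A (x τ)).inverse) t :=
      DifferentiableAt.comp (f := fun τ => A (x τ)) t hmap hAx.differentiableAt
    have hP : DifferentiableAt ℝ P t := by
      refine (hcomp.clm_comp hAinv).congr_of_eventuallyEq (hinv.mono fun τ hτ => ?_)
      change P τ = (P τ ∘L A (x τ)) ∘L (A (x τ)).inverse
      rw [ContinuousLinearMap.comp_assoc, hτ.self_comp_inverse, ContinuousLinearMap.comp_id]
    refine hP.hasDerivAt.congr_deriv (ContinuousLinearMap.ext fun w => ?_)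
    obtain ⟨v, rfl⟩ := hinv.self_of_nhds.surjective w
    have := (hprod hP.hasDerivAt v).unique (h v)
    simp only [neg_apply, ContinuousLinearMap.comp_apply, ContinuousLinearMap.flip_apply]
    linarith

end Calculus

/-! ### Left-invariant fields and the adjoint equation in a chart. -/

section ChartFields

open scoped Topology
open VectorField Set

variable {G : Type*} [Group G] [TopologicalSpace G] [ChartedSpace Model4 G]

/-- The left trivialization of the tangent bundle read in the chart at `h`: at the point with
coordinates `x`, it sends `v` to the coordinates of the left-invariant field of `v`. -/
noncomputable def chartFrame (h : G) (x : Model4) : Model4 →L[ℝ] Model4 :=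
  (mfderiv (𝓡 4) 𝓘(ℝ, Model4) (extChartAt (𝓡 4) h) ((extChartAt (𝓡 4) h).symm x) :
    Model4 →L[ℝ] Model4) ∘L
  (mfderiv (𝓡 4) (𝓡 4) ((extChartAt (𝓡 4) h).symm x * ·) (1 : G) : Model4 →L[ℝ] Model4)

theorem chartFrame_extChartAt {h g : G} (hg : g ∈ (extChartAt (𝓡 4) h).source)
    (v : GroupLieAlgebra (𝓡 4) G) :
    chartFrame h (extChartAt (𝓡 4) h g) v =
      mfderiv (𝓡 4) 𝓘(ℝ, Model4) (extChartAt (𝓡 4) h) g (mulInvariantVectorField v g) := by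
  rw [chartFrame, (extChartAt (𝓡 4) h).left_inv hg]
  rfl

variable [LieGroup (𝓡 4) ∞ G]

theorem isInvertible_chartFrame (h : G) {x : Model4} (hx : x ∈ (extChartAt (𝓡 4) h).target) :
    (chartFrame h x).IsInvertible := by
  have : IsManifold (𝓡 4) 1 G := inferInstance
  exact (isInvertible_mfderiv_extChartAt ((extChartAt (𝓡 4) h).map_target hx)).comp
    (isInvertible_mfderiv_mul_left _ 1)

/-- The manifold Lie bracket is defined through pullbacks by the inverse chart; this identifies
those pullbacks with the frame. -/
theorem mpullbackWithin_mulInvariantVectorField (h : G) (v : GroupLieAlgebra (𝓡 4) G) {x : Model4}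
    (hx : x ∈ (extChartAt (𝓡 4) h).target) :
    mpullbackWithin 𝓘(ℝ, Model4) (𝓡 4) (extChartAt (𝓡 4) h).symm (mulInvariantVectorField v)
      (range (𝓡 4)) x = chartFrame h x v := by
  have : IsManifold (𝓡 4) 1 G := inferInstance
  rw [mpullbackWithin_apply, ContinuousLinearMap.inverse_eq
    (mfderivWithin_extChartAt_symm_comp_mfderiv_extChartAt hx)
    (mfderiv_extChartAt_comp_mfderivWithin_extChartAt_symm hx)]
  rfl

theorem differentiableAt_chartFrame_apply (h : G) (v : Model4) :
    DifferentiableAt ℝ (fun x => chartFrame h x v) (extChartAt (𝓡 4) h h) := by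
  have : IsManifold (𝓡 4) 2 G := inferInstance
  have h1 := contMDiffWithinAt_mpullbackWithin_extChartAt_symm (n := 2) (m := 1) (s := univ)
    (V := mulInvariantVectorField (I := 𝓡 4) v)
    (contMDiff_one_mulInvariantVectorField (G := G) v h).contMDiffWithinAt
    uniqueMDiffOn_univ (mem_univ h) (by norm_num [one_add_one_eq_two])
  rw [contMDiffWithinAt_vectorSpace_iff_contDiffWithinAt] at h1
  have h2 := (h1.contDiffAt (by
    rw [preimage_univ, inter_univ]; exact extChartAt_target_mem_nhds h)).differentiableAt (by simp)
  refine h2.congr_of_eventuallyEq ?_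
  filter_upwards [extChartAt_target_mem_nhds (I := 𝓡 4) h] with x hx
  exact (mpullbackWithin_mulInvariantVectorField h v hx).symm

theorem differentiableAt_chartFrame (h : G) :
    DifferentiableAt ℝ (chartFrame h) (extChartAt (𝓡 4) h h) :=
  differentiableAt_of_forall_apply (differentiableAt_chartFrame_apply h)

/-- In the chart at `h`, the frame turns the bracket of the Lie algebra into the bracket of vector
fields. -/
theorem chartFrame_lie (h : G) (v w : GroupLieAlgebra (𝓡 4) G) :
    chartFrame h (extChartAt (𝓡 4) h h) (⁅v, w⁆ : GroupLieAlgebra (𝓡 4) G) =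
      lieBracket ℝ (fun x => chartFrame h x v) (fun x => chartFrame h x w)
        (extChartAt (𝓡 4) h h) := by
  have : IsManifold (𝓡 4) 1 G := inferInstance
  have hpull (v : GroupLieAlgebra (𝓡 4) G) :
      mpullbackWithin 𝓘(ℝ, Model4) (𝓡 4) (extChartAt (𝓡 4) h).symm (mulInvariantVectorField v)
        (range (𝓡 4)) =ᶠ[𝓝 (extChartAt (𝓡 4) h h)] fun x => chartFrame h x v := by
    filter_upwards [extChartAt_target_mem_nhds (I := 𝓡 4) h] with x hx
    exact mpullbackWithin_mulInvariantVectorField h v hx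
  rw [chartFrame_extChartAt (mem_extChartAt_source h), GroupLieAlgebra.bracket_def,
    mulInvariantVector_mlieBracket, ← mlieBracketWithin_univ, mlieBracketWithin_apply]
  have hinv := isInvertible_mfderiv_extChartAt (I := 𝓡 4) (mem_extChartAt_source (I := 𝓡 4) h)
  -- The derivative of the chart cancels the inverse derivative that carries the coordinate bracket
  -- back to the manifold.
  refine (hinv.self_apply_inverse _).trans ?_
  have hset : (extChartAt (𝓡 4) h).symm ⁻¹' univ ∩ range (𝓡 4) = univ := by
    rw [preimage_univ, univ_inter, ModelWithCorners.range_eq_univ]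
  have hcongr {V W V' W' : Model4 → Model4} {x : Model4} (hV : V =ᶠ[𝓝 x] V')
      (hW : W =ᶠ[𝓝 x] W') : lieBracketWithin ℝ V W univ x = lieBracket ℝ V' W' x := by
    rw [lieBracketWithin_univ, hV.lieBracket_vectorField_eq hW]
  rw [hset]
  exact hcongr (hpull v) (hpull w)

/-- The adjoint equation of the Pontryagin maximum principle in left-invariant coordinates. -/
theorem hasDerivAt_chartCovector_iff {g : ℝ → G}
    {ψ : (t : ℝ) → (TangentSpace (𝓡 4) (g t) →L[ℝ] ℝ)} {t : ℝ} {u : GroupLieAlgebra (𝓡 4) G}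
    (hg : HasMFDerivAt 𝓘(ℝ, ℝ) (𝓡 4) g t
      ((1 : ℝ →L[ℝ] ℝ).smulRight (mulInvariantVectorField (I := 𝓡 4) u (g t)))) :
    HasDerivAt (fun τ => chartCovector (g t) (g τ) (ψ τ))
      (-fderiv ℝ (fun x => chartHamiltonian (g t) u x (chartCovector (g t) (g t) (ψ t)))
        (extChartAt (𝓡 4) (g t) (g t))) t ↔
    ∀ v : GroupLieAlgebra (𝓡 4) G,
      HasDerivAt (fun τ => ψ τ (mulInvariantVectorField (I := 𝓡 4) v (g τ)))
        (ψ t (mulInvariantVectorField (I := 𝓡 4) ⁅u, v⁆ (g t))) t := by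
  have : IsManifold (𝓡 4) 1 G := inferInstance
  have hsrc := mem_extChartAt_source (I := 𝓡 4) (g t)
  have hev : ∀ᶠ τ in 𝓝 t, g τ ∈ (extChartAt (𝓡 4) (g t)).source :=
    hg.continuousAt (extChartAt_source_mem_nhds (I := 𝓡 4) (g t))
  have hpair {τ : ℝ} (hτ : g τ ∈ (extChartAt (𝓡 4) (g t)).source) (v : GroupLieAlgebra (𝓡 4) G) :
      chartCovector (g t) (g τ) (ψ τ)
        (chartFrame (g t) (extChartAt (𝓡 4) (g t) (g τ)) v) =
      ψ τ (mulInvariantVectorField v (g τ)) := by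
    rw [chartFrame_extChartAt hτ]
    exact congrArg (ψ τ) ((isInvertible_mfderiv_extChartAt hτ).inverse_apply_self _)
  have hx : HasDerivAt (fun τ => extChartAt (𝓡 4) (g t) (g τ))
      (chartFrame (g t) (extChartAt (𝓡 4) (g t) (g t)) u) t := by
    have hcomp := (mdifferentiableAt_extChartAt (I := 𝓡 4)
      (ChartedSpace.mem_chart_source (H := Model4) (g t))).hasMFDerivAt.comp t hg
    refine hasDerivAt_iff_hasFDerivAt.2
      ((hasMFDerivAt_iff_hasFDerivAt.1 hcomp).congr_fderiv (ContinuousLinearMap.ext fun (c : ℝ) => ?_))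
    exact (map_smul (mfderiv (𝓡 4) 𝓘(ℝ, Model4) (extChartAt (𝓡 4) (g t)) (g t)) c _).trans
      (congrArg (fun w : Model4 => c • w) (chartFrame_extChartAt hsrc u).symm)
  -- The covector is frozen in `∂H/∂x`, so only the frame field is differentiated.
  have hfd : fderiv ℝ (fun x => chartHamiltonian (g t) u x (chartCovector (g t) (g t) (ψ t)))
      (extChartAt (𝓡 4) (g t) (g t)) = (chartCovector (g t) (g t) (ψ t)) ∘L
        fderiv ℝ (fun x => chartFrame (g t) x u) (extChartAt (𝓡 4) (g t) (g t)) :=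
    ((chartCovector (g t) (g t) (ψ t)).hasFDerivAt.comp _
      (differentiableAt_chartFrame_apply (g t) u).hasFDerivAt).fderiv
  rw [hfd, hasDerivAt_covector_iff hx (differentiableAt_chartFrame (g t))
    (hev.mono fun τ hτ => isInvertible_chartFrame _ ((extChartAt (𝓡 4) (g t)).map_source hτ))]
  refine forall_congr' fun v => ?_
  have hlie : ψ t (mulInvariantVectorField (I := 𝓡 4) ⁅u, v⁆ (g t)) = _ :=
    (hpair hsrc ⁅u, v⁆).symm.trans
      (congrArg (chartCovector (g t) (g t) (ψ t)) (chartFrame_lie (g t) u v))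
  rw [hlie]
  exact Filter.EventuallyEq.hasDerivAt_iff (hev.mono fun τ hτ => hpair hτ v)

end ChartFields

/-! ### Solutions of the maximum principle along integral curves. -/

section Extremals

open scoped Topology
open VectorField Set

variable {G : Type*} [Group G] [TopologicalSpace G] [ChartedSpace Model4 G]

/-- The left-invariant covector field with value `l` at the identity. -/
noncomputable def leftInvariantCovector (l : GroupLieAlgebra (𝓡 4) G →L[ℝ] ℝ) (g : G) :
    TangentSpace (𝓡 4) g →L[ℝ] ℝ :=
  l ∘L (mfderiv (𝓡 4) (𝓡 4) (g * ·) (1 : G) :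
    GroupLieAlgebra (𝓡 4) G →L[ℝ] TangentSpace (𝓡 4) g).inverse

variable [LieGroup (𝓡 4) ∞ G]

theorem mulInvariantVectorField_injective (g : G) :
    Function.Injective fun v : GroupLieAlgebra (𝓡 4) G => mulInvariantVectorField v g :=
  (isInvertible_mfderiv_mul_left g 1).injective

theorem leftInvariantCovector_mulInvariantVectorField (l : GroupLieAlgebra (𝓡 4) G →L[ℝ] ℝ)
    (g : G) (v : GroupLieAlgebra (𝓡 4) G) :
    leftInvariantCovector l g (mulInvariantVectorField v g) = l v :=
  congrArg l ((isInvertible_mfderiv_mul_left g 1).inverse_apply_self v)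

/-- Each composition `f ∘ g` is even `C¹`: its derivative is `df` on the field, which is continuous
along `g`. -/
theorem IsMIntegralCurve.locallyACCurve {v : GroupLieAlgebra (𝓡 4) G} {g : ℝ → G}
    (hg : IsMIntegralCurve g (mulInvariantVectorField (I := 𝓡 4) v)) : LocallyACCurve g := by
  intro f hf
  have hder (t : ℝ) : HasDerivAt (f ∘ g)
      (mfderiv (𝓡 4) 𝓘(ℝ, ℝ) f (g t) (mulInvariantVectorField v (g t)) : ℝ) t := by
    have hcomp := ((hf (g t)).mdifferentiableAt (by simp)).hasMFDerivAt.comp t (hg t)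
    refine hasDerivAt_iff_hasFDerivAt.2
      ((hasMFDerivAt_iff_hasFDerivAt.1 hcomp).congr_fderiv (ContinuousLinearMap.ext fun (c : ℝ) => ?_))
    exact map_smul (mfderiv (𝓡 4) 𝓘(ℝ, ℝ) f (g t)) c _
  have hcont : Continuous fun t =>
      (mfderiv (𝓡 4) 𝓘(ℝ, ℝ) f (g t) (mulInvariantVectorField v (g t)) : ℝ) := by
    have h1 : Continuous fun t => tangentMap (𝓡 4) 𝓘(ℝ, ℝ) f
        (⟨g t, mulInvariantVectorField v (g t)⟩ : TangentBundle (𝓡 4) G) :=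
      (hf.continuous_tangentMap (by simp)).comp
        ((contMDiff_one_mulInvariantVectorField v).continuous.comp hg.continuous)
    exact continuous_snd.comp ((tangentBundleModelSpaceHomeomorph 𝓘(ℝ, ℝ)).continuous.comp h1)
  refine ContDiff.locallyAC (contDiff_one_iff_deriv.2 ⟨fun t => (hder t).differentiableAt, ?_⟩)
  rwa [funext fun t => (hder t).deriv]

/-- An eigencovector of the coadjoint action of the constant control `u` provides a solution of
the Pontryagin maximum principle along the integral curves of `u`. -/
theorem satisfiesPMP_of_eigencovector {q : Submodule ℝ (GroupLieAlgebra (𝓡 4) G)} {F : q → ℝ}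
    {u : q} (hu : F u = 1) {g : ℝ → G}
    (hg : IsMIntegralCurve g (mulInvariantVectorField (I := 𝓡 4) (u : GroupLieAlgebra (𝓡 4) G)))
    {l : GroupLieAlgebra (𝓡 4) G →L[ℝ] ℝ} (hl : l ≠ 0) {k : ℝ}
    (hk : ∀ v, l ⁅(u : GroupLieAlgebra (𝓡 4) G), v⁆ = k * l v) {M : ℝ}
    (hM : ∀ t, Real.exp (k * t) * l u = M)
    (hmax : ∀ t, ∀ w : q, F w ≤ 1 → Real.exp (k * t) * l w ≤ M) :
    SatisfiesPMP q F g (fun _ => u)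
      (fun t => leftInvariantCovector (Real.exp (k * t) • l) (g t)) M where
  curve_ac := hg.locallyACCurve
  control_meas := aestronglyMeasurable_const
  velocity := .of_forall hg
  arclength := .of_forall fun _ => hu
  covector_ne_zero t h := by
    apply hl
    ext v
    have := congrArg (fun ψ => ψ (mulInvariantVectorField (I := 𝓡 4) v (g t))) h
    simp only [leftInvariantCovector_mulInvariantVectorField] at this
    simpa using this
  covector_ac v := by
    simp only [leftInvariantCovector_mulInvariantVectorField]
    exact ContDiff.locallyAC (by simp only [smul_apply, smul_eq_mul]; fun_prop)
  adjoint := .of_forall fun t => by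
    rw [hasDerivAt_chartCovector_iff (hg t)]
    intro v
    simp only [leftInvariantCovector_mulInvariantVectorField, smul_apply, smul_eq_mul, hk]
    have hlin : HasDerivAt (fun y : ℝ => k * y) (k * 1) t := (hasDerivAt_id t).const_mul k
    exact (hlin.exp.mul_const (l v)).congr_deriv (by ring)
  maximum := .of_forall fun t => by
    simp only [leftInvariantCovector_mulInvariantVectorField, smul_apply, smul_eq_mul]
    exact ⟨hM t, hmax t⟩

/-- The curve determines its control, since velocities are unique and left translation is injective
on tangent vectors. Thus any other solution of the maximum principle along `g` differs essentially
only in its covector. -/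
theorem SatisfiesPMP.ae_control_eq {q : Submodule ℝ (GroupLieAlgebra (𝓡 4) G)} {F : q → ℝ}
    {g : ℝ → G} {u : ℝ → q} {ψ : (t : ℝ) → (TangentSpace (𝓡 4) (g t) →L[ℝ] ℝ)} {M : ℝ}
    (h : SatisfiesPMP q F g u ψ M) {w : q}
    (hg : IsMIntegralCurve g (mulInvariantVectorField (I := 𝓡 4) (w : GroupLieAlgebra (𝓡 4) G))) :
    ∀ᵐ t : ℝ, u t = w := by
  filter_upwards [h.velocity] with t ht
  have heq := hasMFDerivAt_unique ht (hg t)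
  apply Subtype.ext
  apply mulInvariantVectorField_injective (g t)
  have hone : (1 : ℝ) • (mulInvariantVectorField (u t : GroupLieAlgebra (𝓡 4) G) (g t) : Model4) =
      (1 : ℝ) • (mulInvariantVectorField (w : GroupLieAlgebra (𝓡 4) G) (g t) : Model4) :=
    congrArg (fun L : ℝ →L[ℝ] Model4 => L 1) heq
  rwa [one_smul, one_smul] at hone

/-- Along an integral curve of a constant control `w`, the component of the covector along an
eigenvector of `ad w` is an exponential. -/
theorem SatisfiesPMP.component_eq_exp {q : Submodule ℝ (GroupLieAlgebra (𝓡 4) G)} {F : q → ℝ}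
    {g : ℝ → G} {u : ℝ → q} {ψ : (t : ℝ) → (TangentSpace (𝓡 4) (g t) →L[ℝ] ℝ)} {M : ℝ}
    (h : SatisfiesPMP q F g u ψ M) {w : q}
    (hg : IsMIntegralCurve g (mulInvariantVectorField (I := 𝓡 4) (w : GroupLieAlgebra (𝓡 4) G)))
    {v : GroupLieAlgebra (𝓡 4) G} {k : ℝ} (hv : ⁅(w : GroupLieAlgebra (𝓡 4) G), v⁆ = k • v)
    (t : ℝ) :
    ψ t (mulInvariantVectorField v (g t)) =
      ψ 0 (mulInvariantVectorField v (g 0)) * Real.exp (k * t) := by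
  refine (h.covector_ac v).eq_exp_of_ae_hasDerivAt ?_ t
  filter_upwards [h.adjoint, h.ae_control_eq hg] with τ hτ hu
  rw [hu, hasDerivAt_chartCovector_iff (hg τ)] at hτ
  refine (hτ v).congr_deriv ?_
  rw [hv, mulInvariantVectorField_smul]
  exact map_smul (ψ τ) k _

/-- If the integral curve of the constant control `c e₂` is a normal extremal, where
`ad e₂` fixes `e₁` and `e₃`, then on the unit ball the `e₂`-coordinate satisfies
`c⁻¹ u₂ ≤ 1`. -/
theorem SatisfiesPMP.coord_mul_inv_le_one {q : Submodule ℝ (GroupLieAlgebra (𝓡 4) G)} {F : q → ℝ}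
    {g : ℝ → G} {u : ℝ → q} {ψ : (t : ℝ) → (TangentSpace (𝓡 4) (g t) →L[ℝ] ℝ)} {M : ℝ}
    (h : SatisfiesPMP q F g u ψ M) (hM : 0 < M) (e : Module.Basis (Fin 3) ℝ q)
    (he1 : ⁅(e 1 : GroupLieAlgebra (𝓡 4) G), (e 0 : GroupLieAlgebra (𝓡 4) G)⁆ = e 0)
    (he3 : ⁅(e 1 : GroupLieAlgebra (𝓡 4) G), (e 2 : GroupLieAlgebra (𝓡 4) G)⁆ = e 2)
    {c : ℝ} (hc : c ≠ 0)
    (hg : IsMIntegralCurve g (mulInvariantVectorField (I := 𝓡 4)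
      ((c • e 1 : q) : GroupLieAlgebra (𝓡 4) G))) {w : q} (hw : F w ≤ 1) :
    c⁻¹ * e.repr w 1 ≤ 1 := by
  have hcoe : ((c • e 1 : q) : GroupLieAlgebra (𝓡 4) G) = c • (e 1 : GroupLieAlgebra (𝓡 4) G) := rfl
  have hp0 := h.component_eq_exp hg (v := e 0) (k := c) (by rw [hcoe, smul_lie, he1])
  have hp1 := h.component_eq_exp hg (v := e 1) (k := 0) (by rw [hcoe, smul_lie, lie_self]; simp)
  have hp2 := h.component_eq_exp hg (v := e 2) (k := c) (by rw [hcoe, smul_lie, he3])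
  set a0 := ψ 0 (mulInvariantVectorField (e 0 : GroupLieAlgebra (𝓡 4) G) (g 0))
  set a1 := ψ 0 (mulInvariantVectorField (e 1 : GroupLieAlgebra (𝓡 4) G) (g 0))
  set a2 := ψ 0 (mulInvariantVectorField (e 2 : GroupLieAlgebra (𝓡 4) G) (g 0))
  have hlin (t : ℝ) (z : q) :
      ψ t (mulInvariantVectorField (z : GroupLieAlgebra (𝓡 4) G) (g t)) =
        e.repr z 1 * a1 + (e.repr z 0 * a0 + e.repr z 2 * a2) * Real.exp (c * t) := by
    have hz : (z : GroupLieAlgebra (𝓡 4) G) =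
        e.repr z 0 • (e 0 : GroupLieAlgebra (𝓡 4) G) + e.repr z 1 • (e 1 : GroupLieAlgebra (𝓡 4) G)
          + e.repr z 2 • (e 2 : GroupLieAlgebra (𝓡 4) G) := by
      have := congrArg q.subtype (e.sum_repr z)
      rw [Fin.sum_univ_three] at this
      exact this.symm
    conv_lhs => rw [hz]
    simp only [mulInvariantVectorField_add, mulInvariantVectorField_smul, Pi.add_apply,
      Pi.smul_apply, map_add, map_smul, hp0, hp1, hp2]
    simp
    ring
  -- One time at which both the maximum condition and `u t = w` hold suffices, because the control
  -- `c e₂` has no `e₁`- or `e₃`-component.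
  have hMeq : M = c * a1 := by
    obtain ⟨t, ht, hut⟩ := (h.maximum.and (h.ae_control_eq hg)).exists
    rw [← ht.1, hut, hlin]
    simp
  have hle : e.repr w 1 * a1 ≤ M := by
    refine le_of_ae_add_mul_exp_le hc (a := e.repr w 0 * a0 + e.repr w 2 * a2) ?_
    filter_upwards [h.maximum] with t ht
    rw [← hlin]
    exact ht.2 w hw
  have hid : c⁻¹ * e.repr w 1 * M = e.repr w 1 * a1 := by
    rw [hMeq]; field_simp
  rw [← hid] at hle
  exact le_of_mul_le_mul_right (by simpa using hle) hM

end Extremals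

theorem proposition12 {G : Type*} [Group G] [TopologicalSpace G] [T2Space G] [ConnectedSpace G]
    [ChartedSpace Model4 G] [LieGroup (𝓡 4) ∞ G]
    (hG : IsG481 (GroupLieAlgebra (𝓡 4) G))
    (q : Submodule ℝ (GroupLieAlgebra (𝓡 4) G))
    (hq : LieSubalgebra.lieSpan ℝ (GroupLieAlgebra (𝓡 4) G)
      (q : Set (GroupLieAlgebra (𝓡 4) G)) = ⊤)
    (e : Module.Basis (Fin 3) ℝ q)
    (he1 : ⁅(e 1 : GroupLieAlgebra (𝓡 4) G), (e 0 : GroupLieAlgebra (𝓡 4) G)⁆ = e 0)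
    (he3 : ⁅(e 1 : GroupLieAlgebra (𝓡 4) G), (e 2 : GroupLieAlgebra (𝓡 4) G)⁆ = e 2)
    (F : q → ℝ) (hF : IsQuasinorm F)
    (s : ℝ) (hs : s = 1 ∨ s = -1) (a : G) :
    IsAbnormalExtremal q F
        (fun t : ℝ => a * lieExp ((s * t / F (s • e 1)) • (e 1 : GroupLieAlgebra (𝓡 4) G))) ∧
    (IsNonstronglyAbnormal q F
        (fun t : ℝ => a * lieExp ((s * t / F (s • e 1)) • (e 1 : GroupLieAlgebra (𝓡 4) G))) ↔
      supportingFunction e F 0 s 0 = 1 / F (s • e 1)) := by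
  have hss : s * s = 1 := by rcases hs with rfl | rfl <;> norm_num
  have hs0 : s ≠ 0 := by rintro rfl; simp at hss
  have hv : s • e 1 ≠ 0 := smul_ne_zero hs0 (e.ne_zero 1)
  have hN : 0 < F (s • e 1) := hF.pos _ hv
  set N := F (s • e 1)
  have hc : s / N ≠ 0 := div_ne_zero hs0 hN.ne'
  have hcinv : (s / N)⁻¹ = s * N := by
    field_simp; rw [sq, hss]
  have hFu : F ((s / N) • e 1) = 1 := by
    rw [div_eq_inv_mul, mul_smul]
    exact hF.map_inv_smul_self hv
  have hg : IsMIntegralCurve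
      (fun t : ℝ => a * lieExp ((s * t / N) • (e 1 : GroupLieAlgebra (𝓡 4) G)))
      (mulInvariantVectorField (I := 𝓡 4) (((s / N) • e 1 : q) : GroupLieAlgebra (𝓡 4) G)) := by
    convert isMIntegralCurve_mul_lieExp (e 1 : GroupLieAlgebra (𝓡 4) G) a (s / N) using 5
    · ring
    · rfl
  have hdim : Module.finrank ℝ (GroupLieAlgebra (𝓡 4) G) = 4 := by
    obtain ⟨E, -⟩ := hG
    simp [Module.finrank_eq_card_basis E]
  obtain ⟨⟨l, hl, hlq, hlad⟩, ⟨m, hm, hmq, hmad⟩⟩ := exists_eigencovectors hdim q hq e he1 he3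
  have : FiniteDimensional ℝ (GroupLieAlgebra (𝓡 4) G) :=
    Module.finite_of_finrank_pos (by omega)
  have : T2Space (GroupLieAlgebra (𝓡 4) G) := inferInstanceAs (T2Space Model4)
  have habn : IsAbnormalExtremal q F
      (fun t : ℝ => a * lieExp ((s * t / N) • (e 1 : GroupLieAlgebra (𝓡 4) G))) := by
    -- The eigenvalue of `ad e₂` is 2 and the control is `(s / N) e₂`, whence the rate `s / N * 2`.
    refine ⟨_, _, satisfiesPMP_of_eigencovector hFu hg (l := LinearMap.toContinuousLinearMap l)
      (k := s / N * 2) ?_ ?_ ?_ ?_⟩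
    · simpa using hl
    · intro v
      simp [hlad, mul_assoc]
    · intro t
      rw [LinearMap.coe_toContinuousLinearMap', hlq, mul_zero]
    · intro t w _
      rw [LinearMap.coe_toContinuousLinearMap', hlq, mul_zero]
  refine ⟨habn, ?_⟩
  rw [supportingFunction_eq_iff hF e hss]
  constructor
  · rintro ⟨-, u, ψ, M, hM, h⟩ w hw
    have := h.coord_mul_inv_le_one hM e he1 he3 hc hg hw
    rw [hcinv] at this
    rw [le_div_iff₀ hN]
    linarith
  · intro h
    -- The factor `s` makes the value on the control positive: `s * (s / N) = 1 / N`. The rate is 0,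
    -- so the covector is left-invariant.
    refine ⟨habn, _, _, 1 / N, by positivity, satisfiesPMP_of_eigencovector hFu hg
      (l := LinearMap.toContinuousLinearMap (s • m)) (k := 0) ?_ ?_ ?_ ?_⟩
    · simpa using ⟨hs0, hm⟩
    · intro v
      simp [hmad]
    · intro t
      rw [LinearMap.coe_toContinuousLinearMap', LinearMap.smul_apply, hmq]
      simp [mul_div_assoc', hss]
    · intro t w hw
      rw [LinearMap.coe_toContinuousLinearMap', LinearMap.smul_apply, hmq]
      simpa using h w hw
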